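/- Call a subset of $\mathbb{R}^2$ a \emph{tile} if it is a simply connected closed polygon all of whose sides are parallel to the coordinate axes, and say that it is \emph{tall} if it has height $1$, i.e. its projection to the vertical axis is an interval of length $1$. A \emph{tiling} of a region $\Gamma\subset\mathbb{R}^2$ with a finite set $T$ of tiles is a collection of translates of tiles in $T$ whose interiors are pairwise disjoint and whose union is $\Gamma$. For $a>0$ let $R_a=[0,a]\times[0,1]$, and let $R_0=\varnothing$ (which has exactly one tiling, the empty one). A function $f:\mathbb{N}\to\mathbb{N}$, where $\mathbb{N}=\{0,1,2,\dots\}$, is a \emph{tile counting function} if there are a real number $\varepsilon\ge 0$ and a finite set $T$ of tall tiles such that, for every $n\in\mathbb{N}$, the number of tilings of $R_{n+\varepsilon}$ with $T$ is finite and equal to $f(n)$. The following functions $\mathbb{N}\to\mathbb{N}$ are tile counting functions: (i) every function $f_1$ with finite support; (ii) every periodic function $f_2$, i.e. one for which there is an integer $p\ge 1$ with $f_2(n+p)=f_2(n)$ for all $n\in\mathbb{N}$; (iii) every polynomial function $f_3(n)=a_pn^p+\dots+a_1n+a_0$ with coefficients $a_i\in\mathbb{N}$; (iv) $f_4(n)=m^n$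 for every $m\in\mathbb{N}$ (with $0^0=1$); (v) $f_5(n)=m^n-1$ for every $m\in\mathbb{N}$ with $m\ge 1$. -/

import Mathlib

namespace IrrationalTiling

/-- An axis-parallel simply connected closed polygon in the plane: a finite union of
nondegenerate closed axis-parallel rectangles `[a₁, b₁] × [a₂, b₂]` (the pairs `(a, b)` in `B`)
that is simply connected and has connected interior. (Connectedness of the interior
excludes pieces that meet only at a corner; with simple connectedness it says
that the set is bounded by one simple closed axis-parallel curve.) -/
structure IsTile (τ : Set (ℝ × ℝ)) : Prop where
  exists_rectangles : ∃ B : Finset ((ℝ × ℝ) × (ℝ × ℝ)),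
    (∀ r ∈ B, r.1.1 < r.2.1 ∧ r.1.2 < r.2.2) ∧ τ = ⋃ r ∈ B, Set.Icc r.1 r.2
  connected_interior : IsConnected (interior τ)
  simplyConnected : IsSimplyConnected τ

/-- A tile of height `1`: its projection to the vertical axis is an interval of length `1`. -/
structure IsTallTile (τ : Set (ℝ × ℝ)) : Prop extends IsTile τ where
  height_one : ∃ y : ℝ, Prod.snd '' τ = Set.Icc y (y + 1)

/-- A tiling of the region `Γ` with the tiles in `T`: a collection of translates of elements
of `T` with pairwise disjoint interiors whose union is `Γ`. -/
structure IsTiling (T : Set (Set (ℝ × ℝ))) (Γ : Set (ℝ × ℝ)) (C : Set (Set (ℝ × ℝ))) :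
    Prop where
  translate : ∀ σ ∈ C, ∃ τ ∈ T, ∃ v : ℝ × ℝ, σ = (fun p => v + p) '' τ
  nonoverlapping : ∀ σ ∈ C, ∀ σ' ∈ C, σ ≠ σ' → Disjoint (interior σ) (interior σ')
  covers : ⋃₀ C = Γ

/-- The rectangle of height `1` and length `a`: this is `[0, a] × [0, 1]` if `a > 0`, and it is
empty if `a ≤ 0` (so that the rectangle of length `0` has exactly one tiling, the empty one). -/
def rectangle (a : ℝ) : Set (ℝ × ℝ) :=
  closure (Set.Ioo 0 a ×ˢ Set.Ioo 0 1)

/-- `f` is a tile counting function: for a fixed `ε ≥ 0` and a fixed finite set `T` of tiles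
of height `1`, the number of tilings of the rectangle of height `1` and length `n + ε` with
the tiles in `T` is finite and equal to `f n`, for every `n`. -/
def IsTileCountingFunction (f : ℕ → ℕ) : Prop :=
  ∃ ε : ℝ, 0 ≤ ε ∧ ∃ T : Set (Set (ℝ × ℝ)), T.Finite ∧ (∀ τ ∈ T, IsTallTile τ) ∧
    ∀ n : ℕ, {C | IsTiling T (rectangle (n + ε)) C}.encard = f n

end IrrationalTiling

/-!
Take tiles that lie between two translates of step curves crossing the strip `0 ≤ y ≤ 1`. In a
tiling of a region, the tile at the left end has the left boundary of the region as its left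
curve, and what is left after its removal is a region of the same kind, beginning with the right
curve of this tile. So the tilings of a region are the walks of given length in a digraph on the
curves. Tiles on the right of the straight curve get the width `√2`, and all others the width `1`.
Then a tiling of a rectangle of length `n + (1 + √2)` uses the straight curve only at its ends,
and there remain the walks with a given number of steps, which are counted by the powers of an
arbitrary `0`-`1` matrix. Splitting vertices into copies gives arbitrary matrices over `ℕ`, so
that every sequence with a linear recurrence over `ℕ` is a tile counting function.
-/

namespace IrrationalTiling

open Set
open scoped Matrix

theorem IsTile.subset_closure_interior {τ : Set (ℝ × ℝ)} (hτ : IsTile τ) :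
    τ ⊆ closure (interior τ) := by
  obtain ⟨B, hB, rfl⟩ := hτ.exists_rectangles
  refine iUnion₂_subset fun r hr => ?_
  calc Icc r.1 r.2 = closure (interior (Icc r.1 r.2)) := by
        obtain ⟨h₁, h₂⟩ := hB r hr
        rw [← Prod.mk.eta (p := r.1), ← Prod.mk.eta (p := r.2), ← Icc_prod_Icc, interior_prod_eq,
          interior_Icc, interior_Icc, closure_prod_eq, closure_Ioo h₁.ne, closure_Ioo h₂.ne]
    _ ⊆ closure (interior (⋃ r ∈ B, Icc r.1 r.2)) :=
        closure_mono (interior_mono (subset_biUnion_of_mem (u := fun r => Icc r.1 r.2) hr))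

theorem IsTiling.subset {T C : Set (Set (ℝ × ℝ))} {Γ σ : Set (ℝ × ℝ)} (hC : IsTiling T Γ C)
    (hσ : σ ∈ C) : σ ⊆ Γ :=
  (subset_sUnion_of_mem hσ).trans hC.covers.subset

theorem contractibleSpace_of_starConvex_slices {E F : Type*} [AddCommGroup E] [Module ℝ E]
    [TopologicalSpace E] [ContinuousAdd E] [ContinuousSMul ℝ E] [AddCommGroup F] [Module ℝ F]
    [TopologicalSpace F] [ContinuousAdd F] [ContinuousSMul ℝ F] {I : Set F} {J : F → Set E}
    {c : E} (hI : Convex ℝ I) (hne : I.Nonempty) (hJ : ∀ y ∈ I, StarConvex ℝ c (J y))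
    (hc : ∀ y ∈ I, c ∈ J y) : ContractibleSpace {p : E × F | p.2 ∈ I ∧ p.1 ∈ J p.2} := by
  have : ContractibleSpace I := hI.contractibleSpace hne
  let proj : C({p : E × F | p.2 ∈ I ∧ p.1 ∈ J p.2}, I) := ⟨fun p => ⟨p.1.2, p.2.1⟩, by fun_prop⟩
  let core : C(I, {p : E × F | p.2 ∈ I ∧ p.1 ∈ J p.2}) :=
    ⟨fun y => ⟨(c, y), y.2, hc y y.2⟩, by fun_prop⟩
  have slide : (core.comp proj).Homotopic (ContinuousMap.id _) :=
    ⟨{  toFun := fun q => ⟨((1 - (q.1 : ℝ)) • c + (q.1 : ℝ) • q.2.1.1, q.2.1.2), q.2.2.1,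
          hJ _ q.2.2.1 q.2.2.2 (sub_nonneg.2 q.1.2.2) q.1.2.1 (sub_add_cancel _ _)⟩
        continuous_toFun := by fun_prop
        map_zero_left := fun p => by ext <;> simp [core, proj]
        map_one_left := fun p => by ext <;> simp }⟩
  exact ContinuousMap.HomotopyEquiv.contractibleSpace
    ⟨proj, core, slide, ContinuousMap.Homotopic.refl _⟩

/-! ### Regions between step curves -/

/-- The lower semicontinuous step function that jumps from `-1/2` to `0` at height `h`. The graph
`x = s + lowerStep h y` is used as the left boundary of closed regions. -/
noncomputable def lowerStep (h y : ℝ) : ℝ := if y ≤ h then -(1 / 2) else 0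

/-- The upper semicontinuous step function that jumps from `-1/2` to `0` at height `h`. The graph
`x = t + upperStep h y` is used as the right boundary of closed regions. -/
noncomputable def upperStep (h y : ℝ) : ℝ := if y < h then -(1 / 2) else 0

/-- The heights of the jumps of the boundary curves. The curve with jump at `-1` is straight within
the strip `0 ≤ y ≤ 1`; all curves are vertical at height `1/2`, which serves to define their
position. -/
def stepHeights : Set ℝ := insert (-1) (Ioo 0 (1 / 2))

/-- The closed region of the strip `0 ≤ y ≤ 1` between the curve with jump at `h` in position `s`
and the curve with jump at `k` in position `t`. -/
def shape (h s k t : ℝ) : Set (ℝ × ℝ) :=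
  {p | p.2 ∈ Icc 0 1 ∧ p.1 ∈ Icc (s + lowerStep h p.2) (t + upperStep k p.2)}

section Step

variable {h k s t y : ℝ}

theorem lowerStep_le_upperStep (h y : ℝ) : lowerStep h y ≤ upperStep h y := by
  grind [lowerStep, upperStep]

theorem upperStep_nonpos (h y : ℝ) : upperStep h y ≤ 0 := by
  grind [upperStep]

theorem lowerStep_nonpos (h y : ℝ) : lowerStep h y ≤ 0 :=
  (lowerStep_le_upperStep h y).trans (upperStep_nonpos h y)

theorem neg_half_le_lowerStep (h y : ℝ) : -(1 / 2) ≤ lowerStep h y := by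
  grind [lowerStep]

theorem neg_half_le_upperStep (h y : ℝ) : -(1 / 2) ≤ upperStep h y :=
  (neg_half_le_lowerStep h y).trans (lowerStep_le_upperStep h y)

theorem lowerStep_eq_zero (hy : h < y) : lowerStep h y = 0 := if_neg hy.not_ge

theorem upperStep_eq_zero (hy : h ≤ y) : upperStep h y = 0 := if_neg hy.not_gt

theorem lt_half_of_mem_stepHeights (hh : h ∈ stepHeights) : h < 1 / 2 := by
  rcases hh with rfl | hh
  · norm_num
  · exact hh.2

theorem lowerStep_half (hh : h ∈ stepHeights) : lowerStep h (1 / 2) = 0 :=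
  lowerStep_eq_zero (lt_half_of_mem_stepHeights hh)

theorem upperStep_half (hh : h ∈ stepHeights) : upperStep h (1 / 2) = 0 :=
  upperStep_eq_zero (lt_half_of_mem_stepHeights hh).le

theorem half_mem_Icc : (1 / 2 : ℝ) ∈ Icc (0 : ℝ) 1 := by norm_num

theorem half_mem_Ioo : (1 / 2 : ℝ) ∈ Ioo (0 : ℝ) 1 := by norm_num

theorem mem_Ioo_of_lt_of_mem_stepHeights (hh : h ∈ stepHeights) (hk : k ∈ stepHeights)
    (hkh : k < h) : h ∈ Ioo 0 (1 / 2) := by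
  rcases hh with rfl | hh
  · rcases hk with rfl | hk
    · exact absurd hkh (lt_irrefl _)
    · linarith [hk.1]
  · exact hh

theorem eq_of_lowerStep_eqOn (hh : h ∈ stepHeights) (hk : k ∈ stepHeights)
    (he : EqOn (lowerStep h) (lowerStep k) (Icc 0 1)) : h = k := by
  by_contra hne
  wlog hkh : k < h generalizing h k
  · exact this hk hh he.symm (Ne.symm hne) (lt_of_le_of_ne (not_lt.1 hkh) hne)
  have hh' := mem_Ioo_of_lt_of_mem_stepHeights hh hk hkh
  have := he (x := h) ⟨hh'.1.le, by linarith [hh'.2]⟩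
  grind [lowerStep]

theorem eq_of_upperStep_eqOn (hh : h ∈ stepHeights) (hk : k ∈ stepHeights)
    (he : EqOn (upperStep h) (upperStep k) (Icc 0 1)) : h = k := by
  by_contra hne
  wlog hkh : k < h generalizing h k
  · exact this hk hh he.symm (Ne.symm hne) (lt_of_le_of_ne (not_lt.1 hkh) hne)
  have hh' := mem_Ioo_of_lt_of_mem_stepHeights hh hk hkh
  have := he (x := max k 0) ⟨le_max_right _ _, by grind⟩
  grind [upperStep]

theorem closure_setOf_upperStep_lt (h s : ℝ) :
    closure {p : ℝ × ℝ | s + upperStep h p.2 < p.1} = {p | s + lowerStep h p.2 ≤ p.1} := by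
  have open_eq : {p : ℝ × ℝ | s + upperStep h p.2 < p.1} =
      Ioi s ×ˢ univ ∪ Ioi (s - 1 / 2) ×ˢ Iio h := by
    ext p
    simp only [upperStep, mem_ofPred_eq, mem_union, mem_prod, mem_Ioi, mem_univ, mem_Iio]
    grind
  rw [open_eq, closure_union, closure_prod_eq, closure_prod_eq, closure_Ioi, closure_Ioi,
    closure_Iio, closure_univ]
  ext p
  simp only [lowerStep, mem_ofPred_eq, mem_union, mem_prod, mem_Ici, mem_univ, mem_Iic]
  grind

theorem closure_setOf_lt_lowerStep (k t : ℝ) :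
    closure {p : ℝ × ℝ | p.1 < t + lowerStep k p.2} = {p | p.1 ≤ t + upperStep k p.2} := by
  have open_eq : {p : ℝ × ℝ | p.1 < t + lowerStep k p.2} =
      Iio (t - 1 / 2) ×ˢ univ ∪ Iio t ×ˢ Ioi k := by
    ext p
    simp only [lowerStep, mem_ofPred_eq, mem_union, mem_prod, mem_Iio, mem_univ, mem_Ioi]
    grind
  rw [open_eq, closure_union, closure_prod_eq, closure_prod_eq, closure_Iio, closure_Iio,
    closure_Ioi, closure_univ]
  ext p
  simp only [upperStep, mem_ofPred_eq, mem_union, mem_prod, mem_Iic, mem_univ, mem_Ici]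
  grind

theorem interior_setOf_lowerStep_le (h s : ℝ) :
    interior {p : ℝ × ℝ | s + lowerStep h p.2 ≤ p.1} = {p | s + upperStep h p.2 < p.1} := by
  have := congrArg compl (closure_setOf_lt_lowerStep h s)
  simpa only [← interior_compl, compl_ofPred, not_lt, not_le] using this

theorem interior_setOf_le_upperStep (k t : ℝ) :
    interior {p : ℝ × ℝ | p.1 ≤ t + upperStep k p.2} = {p | p.1 < t + lowerStep k p.2} := by
  have := congrArg compl (closure_setOf_upperStep_lt k t)
  simpa only [← interior_compl, compl_ofPred, not_lt, not_le] using this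

end Step

section Shape

variable {h s k t h' s' k' t' y : ℝ}

theorem isClosed_shape (h s k t : ℝ) : IsClosed (shape h s k t) := by
  have left : IsClosed {p : ℝ × ℝ | s + lowerStep h p.2 ≤ p.1} := by
    rw [← closure_setOf_upperStep_lt]
    exact isClosed_closure
  have right : IsClosed {p : ℝ × ℝ | p.1 ≤ t + upperStep k p.2} := by
    rw [← closure_setOf_lt_lowerStep]
    exact isClosed_closure
  exact (isClosed_Icc.preimage continuous_snd).inter (left.inter right)

theorem interior_shape (h s k t : ℝ) : interior (shape h s k t) =
    {p | p.2 ∈ Ioo 0 1 ∧ p.1 ∈ Ioo (s + upperStep h p.2) (t + lowerStep k p.2)} := by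
  have strip : interior {p : ℝ × ℝ | p.2 ∈ Icc 0 1} = {p | p.2 ∈ Ioo 0 1} := by
    have := isOpenMap_snd.preimage_interior_eq_interior_preimage
      (continuous_snd (X := ℝ) (Y := ℝ)) (Icc 0 1)
    rw [interior_Icc] at this
    exact this.symm
  calc interior (shape h s k t) = interior ({p | p.2 ∈ Icc 0 1} ∩
        ({p | s + lowerStep h p.2 ≤ p.1} ∩ {p | p.1 ≤ t + upperStep k p.2})) := rfl
    _ = _ := by
      rw [interior_inter, interior_inter, strip, interior_setOf_lowerStep_le,
        interior_setOf_le_upperStep]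
      rfl

theorem left_mem_shape (hst : s + 1 ≤ t) (hy : y ∈ Icc 0 1) :
    (s + lowerStep h y, y) ∈ shape h s k t := by
  refine ⟨hy, le_rfl, ?_⟩
  linarith [lowerStep_nonpos h y, neg_half_le_upperStep k y]

theorem right_mem_shape (hst : s + 1 ≤ t) (hy : y ∈ Icc 0 1) :
    (t + upperStep k y, y) ∈ shape h s k t := by
  refine ⟨hy, ?_, le_rfl⟩
  linarith [lowerStep_nonpos h y, neg_half_le_upperStep k y]

theorem exists_rectangles_shape (hh : h ∈ stepHeights) (hk : k ∈ stepHeights)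
    (hst : s + 1 ≤ t) : ∃ B : Finset ((ℝ × ℝ) × (ℝ × ℝ)),
      (∀ r ∈ B, r.1.1 < r.2.1 ∧ r.1.2 < r.2.2) ∧ shape h s k t = ⋃ r ∈ B, Icc r.1 r.2 := by
  classical
  have hh' := lt_half_of_mem_stepHeights hh
  have hk' := lt_half_of_mem_stepHeights hk
  refine ⟨{((s, 0), (t - 1 / 2, 1)), ((s, max k 0), (t, 1)),
    if 0 < h then ((s - 1 / 2, 0), (s, h)) else ((s, 0), (t - 1 / 2, 1))}, ?_, ?_⟩
  · simp only [Finset.mem_insert, Finset.mem_singleton]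
    grind
  · ext ⟨x, y⟩
    simp only [shape, lowerStep, upperStep, Finset.mem_insert, Finset.mem_singleton, mem_iUnion,
      exists_prop, or_and_right, exists_or, exists_eq_left, mem_ofPred_eq, mem_Icc]
    have hh₀ : 0 < h ∨ h < 0 := hh.elim (fun hh => .inr (by linarith)) (fun hh => .inl hh.1)
    rcases hh₀ with hh₀ | hh₀ <;> rcases le_total k 0 with hk₀ | hk₀ <;>
      simp only [hh₀, hh₀.not_gt, if_true, if_false, max_eq_left, max_eq_right, hk₀,
        Prod.mk_le_mk] <;>
      grind

theorem isSimplyConnected_shape (h k : ℝ) (hst : s + 1 ≤ t) :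
    IsSimplyConnected (shape h s k t) := by
  have core (y : ℝ) : s + 1 / 4 ∈ Icc (s + lowerStep h y) (t + upperStep k y) :=
    ⟨by linarith [lowerStep_nonpos h y], by linarith [neg_half_le_upperStep k y]⟩
  have : ContractibleSpace (shape h s k t) :=
    contractibleSpace_of_starConvex_slices (convex_Icc 0 1) (nonempty_Icc.2 zero_le_one)
      (fun y _ => (convex_Icc _ _).starConvex (core y)) (fun y _ => core y)
  exact SimplyConnectedSpace.ofContractible _

theorem isConnected_interior_shape (h k : ℝ) (hst : s + 1 ≤ t) :
    IsConnected (interior (shape h s k t)) := by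
  have core (y : ℝ) : s + 1 / 4 ∈ Ioo (s + upperStep h y) (t + lowerStep k y) :=
    ⟨by linarith [upperStep_nonpos h y], by linarith [neg_half_le_lowerStep k y]⟩
  rw [interior_shape, isConnected_iff_connectedSpace]
  have : ContractibleSpace {p : ℝ × ℝ | p.2 ∈ Ioo 0 1 ∧
      p.1 ∈ Ioo (s + upperStep h p.2) (t + lowerStep k p.2)} :=
    contractibleSpace_of_starConvex_slices (convex_Ioo 0 1) (nonempty_Ioo.2 zero_lt_one)
      (fun y _ => (convex_Ioo _ _).starConvex (core y)) (fun y _ => core y)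
  infer_instance

theorem image_snd_shape (h k : ℝ) (hst : s + 1 ≤ t) : Prod.snd '' shape h s k t = Icc 0 1 :=
  (image_subset_iff.2 fun _ hp => hp.1).antisymm fun _ hy => ⟨_, left_mem_shape hst hy, rfl⟩

theorem isTallTile_shape (hh : h ∈ stepHeights) (hk : k ∈ stepHeights) (hst : s + 1 ≤ t) :
    IsTallTile (shape h s k t) where
  exists_rectangles := exists_rectangles_shape hh hk hst
  connected_interior := isConnected_interior_shape h k hst
  simplyConnected := isSimplyConnected_shape h k hst
  height_one := ⟨0, by rw [image_snd_shape h k hst, zero_add]⟩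

theorem image_add_shape (x h s k t : ℝ) :
    (fun p => (x, (0 : ℝ)) + p) '' shape h s k t = shape h (x + s) k (x + t) := by
  ext p
  simp only [image_add_left, mem_preimage, shape, mem_ofPred_eq, mem_Icc, Prod.fst_add,
    Prod.snd_add, Prod.neg_mk, neg_zero, zero_add]
  constructor <;> rintro ⟨hy, h₁, h₂⟩ <;> exact ⟨hy, by linarith, by linarith⟩

theorem snd_eq_zero_of_image_add_shape_subset {v : ℝ × ℝ} (hst : s + 1 ≤ t)
    (hv : (fun p => v + p) '' shape h s k t ⊆ shape h' s' k' t') : v.2 = 0 := by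
  have bottom := (hv ⟨_, left_mem_shape hst (left_mem_Icc.2 zero_le_one), rfl⟩).1.1
  have top := (hv ⟨_, left_mem_shape hst (right_mem_Icc.2 zero_le_one), rfl⟩).1.2
  simp only [Prod.snd_add] at bottom top
  linarith

theorem rectangle_eq_shape {a : ℝ} (ha : 0 < a) : rectangle a = shape (-1) 0 (-1) a := by
  rw [rectangle, closure_prod_eq, closure_Ioo ha.ne, closure_Ioo zero_ne_one]
  ext p
  simp only [mem_prod, shape, mem_ofPred_eq, mem_Icc, lowerStep, upperStep]
  grind

theorem le_or_le_of_disjoint_interior_shape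
    (hd : Disjoint (interior (shape h s k t)) (interior (shape h' s' k' t')))
    (hy : y ∈ Ioo 0 1) (hst : s + 1 ≤ t) (hst' : s' + 1 ≤ t') :
    t + lowerStep k y ≤ s' + upperStep h' y ∨ t' + lowerStep k' y ≤ s + upperStep h y := by
  rw [interior_shape, interior_shape, disjoint_left] at hd
  have slices : Disjoint (Ioo (s + upperStep h y) (t + lowerStep k y))
      (Ioo (s' + upperStep h' y) (t' + lowerStep k' y)) :=
    disjoint_left.2 fun x hx hx' => hd (a := (x, y)) ⟨hy, hx⟩ ⟨hy, hx'⟩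
  rw [Ioo_disjoint_Ioo, min_le_iff, le_max_iff, le_max_iff] at slices
  have := upperStep_nonpos h y
  have := upperStep_nonpos h' y
  have := neg_half_le_lowerStep k y
  have := neg_half_le_lowerStep k' y
  grind

theorem disjoint_interior_shape (h s k t l u : ℝ) :
    Disjoint (interior (shape h s k t)) (interior (shape k t l u)) := by
  rw [interior_shape, interior_shape, disjoint_left]
  intro p hp hp'
  linarith [hp.2.2, hp'.2.1, lowerStep_le_upperStep k p.2]

theorem shape_union_shape {l u : ℝ} (hst : s + 1 ≤ t) (htu : t + 1 ≤ u) :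
    shape h s k t ∪ shape k t l u = shape h s l u := by
  ext p
  have := lowerStep_le_upperStep k p.2
  have := neg_half_le_lowerStep k p.2
  have := upperStep_nonpos k p.2
  have := lowerStep_nonpos h p.2
  have := neg_half_le_upperStep l p.2
  simp only [shape, mem_union, mem_ofPred_eq, mem_Icc]
  grind

theorem le_and_le_of_shape_subset (hh : h ∈ stepHeights) (hk : k ∈ stepHeights)
    (hh' : h' ∈ stepHeights) (hk' : k' ∈ stepHeights) (hst : s + 1 ≤ t)
    (hsub : shape h s k t ⊆ shape h' s' k' t') : s' ≤ s ∧ t ≤ t' := by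
  have left := (hsub (left_mem_shape hst half_mem_Icc)).2.1
  have right := (hsub (right_mem_shape hst half_mem_Icc)).2.2
  simp only [lowerStep_half, upperStep_half, add_zero, *] at left right
  exact ⟨left, right⟩

theorem right_eq_of_shape_eq (hk : k ∈ stepHeights) (hk' : k' ∈ stepHeights) (hst : s + 1 ≤ t)
    (he : shape h s k t = shape h' s' k' t) (hst' : s' + 1 ≤ t) : k = k' := by
  refine eq_of_upperStep_eqOn hk hk' fun y hy => le_antisymm ?_ ?_
  · simpa using (he.subset (right_mem_shape hst hy)).2.2
  · simpa using (he.symm.subset (right_mem_shape hst' hy)).2.2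

end Shape

/-! ### Tilings as walks -/

/-- Prescription for the tiles of a set: the tiles lie between two step curves, where the curves are
indexed by `Q`, the `q`-th curve jumps at `height q`, the tiles with the `q`-th curve on the left
have width `width q`, and `next q j` says that there is such a tile with the `j`-th curve on the
right. Tilings with these tiles are thus walks in the digraph `next`. -/
structure TileSystem (Q : Type*) where
  height : Q → ℝ
  width : Q → ℝ
  next : Q → Q → Prop
  height_mem : ∀ q, height q ∈ stepHeights
  height_injective : Function.Injective height
  one_le_width : ∀ q, 1 ≤ width q

namespace TileSystem

variable {Q : Type*} (S : TileSystem Q) {i j k q r : Q} {s a u : ℝ} {C : Set (Set (ℝ × ℝ))}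
  {σ : Set (ℝ × ℝ)}

/-- The region between the `q`-th curve in position `s` and the `r`-th curve in position `a`. -/
abbrev region (q : Q) (s : ℝ) (r : Q) (a : ℝ) : Set (ℝ × ℝ) :=
  shape (S.height q) s (S.height r) a

/-- The tile with the `q`-th curve in position `s` on the left and the `j`-th curve on the right. -/
abbrev tile (q : Q) (s : ℝ) (j : Q) : Set (ℝ × ℝ) :=
  S.region q s j (s + S.width q)

/-- The set of tiles of the system, in position `0`. -/
def tiles : Set (Set (ℝ × ℝ)) :=
  {τ | ∃ q j, S.next q j ∧ τ = S.tile q 0 j}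

/-- The number of tilings of a region with the tiles of the system. -/
noncomputable def tilingCount (q : Q) (s : ℝ) (r : Q) (a : ℝ) : ℕ∞ :=
  {C | IsTiling S.tiles (S.region q s r a) C}.encard

theorem finite_tiles [Finite Q] : S.tiles.Finite := by
  refine (finite_range fun p : Q × Q => S.tile p.1 0 p.2).subset ?_
  rintro _ ⟨q, j, -, rfl⟩
  exact ⟨(q, j), rfl⟩

theorem add_one_le_add_width (q : Q) (s : ℝ) : s + 1 ≤ s + S.width q := by
  linarith [S.one_le_width q]

variable {S}

theorem isTallTile_region (hsa : s + 1 ≤ a) : IsTallTile (S.region q s r a) :=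
  isTallTile_shape (S.height_mem q) (S.height_mem r) hsa

theorem isTallTile_of_mem_tiles (hσ : σ ∈ S.tiles) : IsTallTile σ := by
  obtain ⟨q, j, -, rfl⟩ := hσ
  exact isTallTile_region (S.add_one_le_add_width q 0)

theorem image_add_tile (x : ℝ) (q : Q) (s : ℝ) (j : Q) :
    (fun p => (x, (0 : ℝ)) + p) '' S.tile q s j = S.tile q (x + s) j := by
  rw [image_add_shape, ← add_assoc]

theorem tile_injective (he : S.tile q s j = S.tile q s k) : j = k :=
  S.height_injective <| right_eq_of_shape_eq (S.height_mem j) (S.height_mem k)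
    (S.add_one_le_add_width q s) he (S.add_one_le_add_width q s)

theorem add_width_le_or_add_width_le
    (hd : Disjoint (interior (S.tile q s j)) (interior (S.tile i u k))) :
    s + S.width q ≤ u ∨ u + S.width i ≤ s := by
  have := le_or_le_of_disjoint_interior_shape hd half_mem_Ioo (S.add_one_le_add_width q s)
    (S.add_one_le_add_width i u)
  simpa only [lowerStep_half (S.height_mem _), upperStep_half (S.height_mem _), add_zero] using this

section Tiling

variable (hC : IsTiling S.tiles (S.region q s r a) C)
include hC

theorem exists_eq_tile (hσ : σ ∈ C) :
    ∃ i u k, S.next i k ∧ σ = S.tile i u k ∧ s ≤ u ∧ u + S.width i ≤ a := by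
  obtain ⟨_, ⟨i, k, hk, rfl⟩, ⟨u, y⟩, rfl⟩ := hC.translate σ hσ
  have hsub := hC.subset hσ
  obtain rfl : y = 0 := snd_eq_zero_of_image_add_shape_subset (S.add_one_le_add_width i 0) hsub
  rw [image_add_tile, add_zero] at hsub ⊢
  exact ⟨i, u, k, hk, rfl, le_and_le_of_shape_subset (S.height_mem _) (S.height_mem _)
    (S.height_mem _) (S.height_mem _) (S.add_one_le_add_width i u) hsub⟩

theorem finite_of_isTiling : C.Finite := by
  choose i u k _ hu hsu hua using fun σ : C => exists_eq_tile hC σ.2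
  have floor_mem (σ : C) : ⌊u σ⌋ ∈ Icc ⌊s⌋ ⌊a⌋ :=
    ⟨Int.floor_le_floor (hsu σ),
      Int.floor_le_floor (by linarith [hua σ, S.one_le_width (i σ)])⟩
  refine Finite.of_injective (fun σ => (⟨⌊u σ⌋, floor_mem σ⟩ : Icc ⌊s⌋ ⌊a⌋)) fun σ σ' he => ?_
  have close := abs_lt.1 (Int.abs_sub_lt_one_of_floor_eq_floor (congrArg Subtype.val he))
  by_contra hne
  have hd := hC.nonoverlapping σ σ.2 σ' σ'.2 (Subtype.coe_injective.ne hne)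
  rw [hu σ, hu σ'] at hd
  rcases add_width_le_or_add_width_le hd with h | h <;>
    linarith [close.1, close.2, S.one_le_width (i σ), S.one_le_width (i σ')]

theorem add_width_le_of_tile_mem (hfirst : S.tile i s j ∈ C) : s + S.width i ≤ a :=
  (le_and_le_of_shape_subset (S.height_mem _) (S.height_mem _) (S.height_mem _) (S.height_mem _)
    (S.add_one_le_add_width i s) (hC.subset hfirst)).2

theorem exists_eq_tile_of_ne (hfirst : S.tile i s j ∈ C) (hσ : σ ∈ C) (hne : σ ≠ S.tile i s j) :
    ∃ i' u k, σ = S.tile i' u k ∧ s + S.width i ≤ u ∧ u + S.width i' ≤ a := by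
  obtain ⟨i', u, k, -, rfl, hsu, hua⟩ := exists_eq_tile hC hσ
  refine ⟨i', u, k, rfl, ?_, hua⟩
  rcases add_width_le_or_add_width_le (hC.nonoverlapping _ hfirst _ hσ hne.symm) with h | h
  · exact h
  · linarith [S.one_le_width i']

theorem eq_of_tile_mem (hj : S.tile q s j ∈ C) (hk : S.tile q s k ∈ C) : j = k := by
  by_contra hjk
  have hd := hC.nonoverlapping _ hj _ hk (mt tile_injective hjk)
  rcases add_width_le_or_add_width_le hd with h | h <;> linarith [S.one_le_width q]

theorem exists_tile_mem (hsa : s < a) : ∃ j, S.next q j ∧ S.tile q s j ∈ C := by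
  have corner : (s, (1 / 2 : ℝ)) ∈ ⋃₀ C := by
    rw [hC.covers]
    refine ⟨half_mem_Icc, ?_, ?_⟩ <;>
      simp only [lowerStep_half (S.height_mem _), upperStep_half (S.height_mem _), add_zero, le_rfl,
        hsa.le]
  obtain ⟨σ, hσ, hcorner⟩ := corner
  obtain ⟨i, u, j, hij, rfl, hsu, hua⟩ := exists_eq_tile hC hσ
  obtain rfl : u = s := by
    have := hcorner.2.1
    rw [lowerStep_half (S.height_mem _), add_zero] at this
    exact this.antisymm hsu
  have left_mem {y : ℝ} (hy : y ∈ Icc 0 1) : (u + lowerStep (S.height q) y, y) ∈ S.tile i u j := by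
    have hleft : (u + lowerStep (S.height q) y, y) ∈ ⋃₀ C := by
      rw [hC.covers]
      exact left_mem_shape ((S.add_one_le_add_width i u).trans hua) hy
    obtain ⟨σ', hσ', hy'⟩ := hleft
    by_contra hnot
    obtain ⟨i', u', k', rfl, huu', -⟩ :=
      exists_eq_tile_of_ne hC hσ hσ' fun he => hnot (he ▸ hy')
    linarith [hy'.2.1, S.one_le_width i, lowerStep_nonpos (S.height q) y,
      neg_half_le_lowerStep (S.height i') y]
  obtain rfl : i = q := by
    refine S.height_injective <|
      eq_of_lowerStep_eqOn (S.height_mem _) (S.height_mem _) fun y hy => ?_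
    have hle := (left_mem hy).2.1
    have hge := (hC.subset hσ (left_mem_shape (S.add_one_le_add_width i u) hy)).2.1
    exact le_antisymm (by simpa using hle) (by simpa using hge)
  exact ⟨j, hij, hσ⟩

theorem add_width_add_one_le (hfirst : S.tile q s j ∈ C) (hlt : s + S.width q < a) :
    s + S.width q + 1 ≤ a := by
  have corner : (a, (1 / 2 : ℝ)) ∈ ⋃₀ C := by
    rw [hC.covers]
    refine ⟨half_mem_Icc, ?_, ?_⟩ <;>
      simp only [lowerStep_half (S.height_mem _), upperStep_half (S.height_mem _), add_zero, le_rfl]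
    linarith [S.one_le_width q]
  obtain ⟨σ, hσ, hcorner⟩ := corner
  obtain ⟨i, u, k, -, hu, hua⟩ := exists_eq_tile_of_ne hC hfirst hσ <| by
    rintro rfl
    have := hcorner.2.2
    rw [upperStep_half (S.height_mem _), add_zero] at this
    exact hlt.not_ge this
  linarith [S.one_le_width i]

theorem subset_region_of_ne_tile (hfirst : S.tile q s j ∈ C) (hσ : σ ∈ C) (hne : σ ≠ S.tile q s j) :
    σ ⊆ S.region j (s + S.width q) r a := by
  obtain ⟨i, u, k, rfl, hu, -⟩ := exists_eq_tile_of_ne hC hfirst hσ hne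
  refine (isTallTile_region (S.add_one_le_add_width i u)).subset_closure_interior.trans
    (closure_minimal (fun p hp => ?_) (isClosed_shape _ _ _ _))
  have hregion := hC.subset hσ (interior_subset hp)
  rw [interior_shape] at hp
  have order := le_or_le_of_disjoint_interior_shape (hC.nonoverlapping _ hfirst _ hσ hne.symm) hp.1
    (S.add_one_le_add_width q s) (S.add_one_le_add_width i u)
  refine ⟨hregion.1, ?_, hregion.2.2⟩
  rcases order with h | h
  · linarith [hp.2.1, h]
  · linarith [S.one_le_width q, S.one_le_width i, upperStep_nonpos (S.height q) p.2,
      neg_half_le_lowerStep (S.height k) p.2]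

theorem isTiling_diff_tile (hfirst : S.tile q s j ∈ C) (hle : s + S.width q + 1 ≤ a) :
    IsTiling S.tiles (S.region j (s + S.width q) r a) (C \ {S.tile q s j}) where
  translate σ hσ := hC.translate σ hσ.1
  nonoverlapping σ hσ σ' hσ' := hC.nonoverlapping σ hσ.1 σ' hσ'.1
  covers := by
    refine (sUnion_subset fun σ hσ => subset_region_of_ne_tile hC hfirst hσ.1 hσ.2).antisymm ?_
    have closed : IsClosed (⋃₀ (C \ {S.tile q s j})) := by
      rw [sUnion_eq_biUnion]
      refine ((finite_of_isTiling hC).subset sdiff_subset).isClosed_biUnion fun σ hσ => ?_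
      obtain ⟨i, u, k, -, rfl, -⟩ := exists_eq_tile hC hσ.1
      exact isClosed_shape _ _ _ _
    refine (isTallTile_region hle).subset_closure_interior.trans
      (closure_minimal (fun p hp => ?_) closed)
    have hp' : p ∈ ⋃₀ C := by
      rw [hC.covers, region, ← shape_union_shape (S.add_one_le_add_width q s) hle]
      exact Or.inr (interior_subset hp)
    obtain ⟨σ, hσ, hpσ⟩ := hp'
    rw [interior_shape] at hp
    exact ⟨σ, ⟨hσ, fun he => (he.subset hpσ).2.2.not_gt hp.2.1⟩, hpσ⟩

theorem tile_notMem (hlt : u < s) : S.tile i u k ∉ C := fun hmem =>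
  hlt.not_ge (le_and_le_of_shape_subset (S.height_mem _) (S.height_mem _) (S.height_mem _)
    (S.height_mem _) (S.add_one_le_add_width i u) (hC.subset hmem)).1

end Tiling

theorem exists_image_add_tile (hqj : S.next q j) (s : ℝ) :
    ∃ τ ∈ S.tiles, ∃ v : ℝ × ℝ, S.tile q s j = (fun p => v + p) '' τ :=
  ⟨_, ⟨q, j, hqj, rfl⟩, (s, 0), by rw [image_add_tile, add_zero]⟩

theorem isTiling_insert_tile (hqj : S.next q j) (hle : s + S.width q + 1 ≤ a)
    (hC : IsTiling S.tiles (S.region j (s + S.width q) r a) C) :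
    IsTiling S.tiles (S.region q s r a) (insert (S.tile q s j) C) := by
  have disjoint {σ} (hσ : σ ∈ C) : Disjoint (interior (S.tile q s j)) (interior σ) :=
    (disjoint_interior_shape _ _ _ _ _ _).mono_right (interior_mono (hC.subset hσ))
  refine ⟨?_, ?_, ?_⟩
  · rintro σ (rfl | hσ)
    · exact exists_image_add_tile hqj s
    · exact hC.translate σ hσ
  · rintro σ (rfl | hσ) σ' (rfl | hσ') hne
    · exact absurd rfl hne
    · exact disjoint hσ'
    · exact (disjoint hσ).symm
    · exact hC.nonoverlapping σ hσ σ' hσ' hne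
  · rw [sUnion_insert, hC.covers, shape_union_shape (S.add_one_le_add_width q s) hle]

theorem isTiling_singleton (hqj : S.next q j) (s : ℝ) :
    IsTiling S.tiles (S.tile q s j) {S.tile q s j} := by
  refine ⟨?_, ?_, sUnion_singleton _⟩
  · rintro σ rfl
    exact exists_image_add_tile hqj s
  · rintro σ rfl σ' rfl hne
    exact absurd rfl hne

theorem isTiling_tile_iff :
    IsTiling S.tiles (S.tile q s r) C ↔ S.next q r ∧ C = {S.tile q s r} := by
  refine ⟨fun hC => ?_, fun ⟨hqr, hC⟩ => hC ▸ isTiling_singleton hqr s⟩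
  obtain ⟨j, hqj, hfirst⟩ := exists_tile_mem hC (by linarith [S.one_le_width q])
  have C_eq : C = {S.tile q s j} := by
    refine eq_singleton_iff_unique_mem.2 ⟨hfirst, fun σ hσ => ?_⟩
    by_contra hne
    obtain ⟨i, u, k, -, hu, hua⟩ := exists_eq_tile_of_ne hC hfirst hσ hne
    linarith [S.one_le_width i]
  obtain rfl : j = r := tile_injective (by simpa [C_eq] using hC.covers)
  exact ⟨hqj, C_eq⟩

open Classical in
theorem tilingCount_add_width (q : Q) (s : ℝ) (r : Q) :
    S.tilingCount q s r (s + S.width q) = if S.next q r then 1 else 0 := by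
  simp only [tilingCount, isTiling_tile_iff]
  split_ifs with h <;> simp [h]

theorem setOf_isTiling_eq_iUnion (hle : s + S.width q + 1 ≤ a) :
    {C | IsTiling S.tiles (S.region q s r a) C} = ⋃ j ∈ {j | S.next q j},
      insert (S.tile q s j) '' {C | IsTiling S.tiles (S.region j (s + S.width q) r a) C} := by
  ext C
  simp only [mem_iUnion, mem_image, mem_ofPred_eq, exists_prop]
  constructor
  · intro hC
    obtain ⟨j, hqj, hfirst⟩ := exists_tile_mem hC (by linarith [S.one_le_width q])
    exact ⟨j, hqj, _, isTiling_diff_tile hC hfirst hle, by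
      rw [insert_sdiff_singleton, insert_eq_of_mem hfirst]⟩
  · rintro ⟨j, hqj, C, hC, rfl⟩
    exact isTiling_insert_tile hqj hle hC

open Classical in
theorem tilingCount_eq_sum [Fintype Q] (hle : s + S.width q + 1 ≤ a) :
    S.tilingCount q s r a = ∑ j with S.next q j, S.tilingCount j (s + S.width q) r a := by
  have disjoint : {j | S.next q j}.PairwiseDisjoint fun j => insert (S.tile q s j) ''
      {C | IsTiling S.tiles (S.region j (s + S.width q) r a) C} := by
    intro j hqj k _ hjk
    refine disjoint_left.2 ?_
    rintro _ ⟨C, hC, rfl⟩ ⟨C', _, he⟩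
    refine hjk (eq_of_tile_mem (isTiling_insert_tile hqj hle hC) (mem_insert _ _) ?_)
    exact he ▸ mem_insert _ _
  have injective (j : Q) : InjOn (insert (S.tile q s j))
      {C | IsTiling S.tiles (S.region j (s + S.width q) r a) C} := by
    intro C hC C' hC' he
    have hlt : s < s + S.width q := by linarith [S.one_le_width q]
    rw [← insert_sdiff_self_of_notMem (tile_notMem hC hlt),
      ← insert_sdiff_self_of_notMem (tile_notMem hC' hlt), he]
  rw [tilingCount, setOf_isTiling_eq_iUnion hle, (toFinite _).encard_biUnion disjoint,
    finsum_mem_eq_toFinset_sum]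
  simp only [(injective _).encard_image, toFinset_ofPred, tilingCount]

theorem exists_sub_eq_sum_width [Fintype Q] (hsa : s < a)
    (hC : IsTiling S.tiles (S.region q s r a) C) :
    ∃ m : Q → ℕ, m q ≠ 0 ∧ a - s = ∑ p, m p * S.width p := by
  classical
  obtain ⟨N, hN⟩ := exists_nat_ge (a - s)
  induction N generalizing q s C with
  | zero => linarith [hN.trans_eq Nat.cast_zero]
  | succ N ih =>
    obtain ⟨j, -, hfirst⟩ := exists_tile_mem hC hsa
    have single : ∑ p, (Pi.single q 1 : Q → ℕ) p * S.width p = S.width q := by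
      simp [Pi.single_apply]
    rcases (add_width_le_of_tile_mem hC hfirst).eq_or_lt with heq | hlt
    · exact ⟨Pi.single q 1, by simp, by rw [single, ← heq, add_sub_cancel_left]⟩
    · obtain ⟨m, -, hm⟩ := ih hlt
        (isTiling_diff_tile hC hfirst (add_width_add_one_le hC hfirst hlt))
        (by push_cast at hN; linarith [S.one_le_width q])
      refine ⟨Pi.single q 1 + m, by simp, ?_⟩
      simp only [Pi.add_apply, Nat.cast_add, add_mul, Finset.sum_add_distrib, single, ← hm]
      ring

end TileSystem

/-! ### Counting walks -/

/-- The tile system of a digraph `step` on `κ` with sets of `start` and `finish` vertices. The curve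
of the vertex `x` jumps at `e x`, and `none` stands for the straight curve, so that a tiling of a
rectangle is a closed walk through `none`. The tiles on the right of the straight curve have
irrational width, and all others have width `1`. -/
noncomputable def digraphSystem {κ : Type*} (e : κ ↪ Ioo (0 : ℝ) (1 / 2)) (start finish : κ → Prop)
    (step : κ → κ → Prop) : TileSystem (Option κ) where
  height q := q.elim (-1) fun x => e x
  width q := q.elim √2 1
  next
    | none, none => False
    | none, some x => start x
    | some x, none => finish x
    | some x, some y => step x y
  height_mem
    | none => .inl rfl
    | some x => .inr (e x).2
  height_injective := Option.injective_iff.2 ⟨Subtype.val_injective.comp e.injective, by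
    rintro ⟨x, hx⟩
    have := (e x).2.1
    simp only [Function.comp_apply, Option.elim_some, Option.elim_none] at hx
    linarith⟩
  one_le_width
    | none => Real.one_le_sqrt.2 one_le_two
    | some _ => le_rfl

namespace digraphSystem

variable {κ : Type*} {e : κ ↪ Ioo (0 : ℝ) (1 / 2)} {start finish : κ → Prop}
  {step : κ → κ → Prop}

theorem tilingCount_none_eq_zero [Finite κ] (a : ℝ) (n : ℕ) (r : Option κ) :
    (digraphSystem e start finish step).tilingCount none (a - (n + 1 : ℕ)) r a = 0 := by
  rw [TileSystem.tilingCount, encard_eq_zero, eq_empty_iff_forall_notMem]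
  intro C hC
  have := Fintype.ofFinite κ
  have hlt : a - (n + 1 : ℕ) < a := sub_lt_self _ (Nat.cast_pos.2 n.succ_pos)
  obtain ⟨m, hm, hsum⟩ := TileSystem.exists_sub_eq_sum_width hlt hC
  refine ((irrational_sqrt_two.natCast_mul hm).add_natCast (∑ x, m (some x))).ne_nat (n + 1) ?_
  simpa [digraphSystem, Fintype.sum_option] using hsum.symm

open Classical in
theorem tilingCount_eq_sum_some [Fintype κ] (a : ℝ) (n : ℕ) (q : Option κ) :
    (digraphSystem e start finish step).tilingCount q
        (a - (n + 1 : ℕ) - (digraphSystem e start finish step).width q) none a =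
      ∑ x with (digraphSystem e start finish step).next q (some x),
        (digraphSystem e start finish step).tilingCount (some x) (a - (n + 1 : ℕ)) none a := by
  rw [TileSystem.tilingCount_eq_sum (by push_cast; linarith [n.cast_nonneg (α := ℝ)]),
    sub_add_cancel, Finset.sum_filter, Finset.sum_filter, Fintype.sum_option,
    tilingCount_none_eq_zero, ite_self, zero_add]

open Classical in
theorem tilingCount_some [Fintype κ] {g : ℕ → κ → ℕ}
    (hg₀ : ∀ x, g 0 x = if finish x then 1 else 0)
    (hg : ∀ n x, g (n + 1) x = ∑ y with step x y, g n y) (a : ℝ) (n : ℕ) (x : κ) :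
    (digraphSystem e start finish step).tilingCount (some x) (a - (n + 1 : ℕ)) none a = g n x := by
  induction n generalizing x with
  | zero =>
    have last : (digraphSystem e start finish step).tilingCount (some x) (a - 1) none (a - 1 + 1) =
      if finish x then 1 else 0 := TileSystem.tilingCount_add_width _ _ _
    rw [hg₀, zero_add, Nat.cast_one, Nat.cast_ite, Nat.cast_one, Nat.cast_zero]
    rwa [sub_add_cancel] at last
  | succ n ih =>
    calc (digraphSystem e start finish step).tilingCount (some x) (a - (n + 1 + 1 : ℕ)) none a
        = (digraphSystem e start finish step).tilingCount (some x)
            (a - (n + 1 : ℕ) - 1) none a := by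
          rw [Nat.cast_succ (n + 1), sub_sub]
      _ = ∑ y with step x y,
            (digraphSystem e start finish step).tilingCount (some y) (a - (n + 1 : ℕ)) none a :=
          tilingCount_eq_sum_some a n (some x)
      _ = g (n + 1) x := by simp only [ih, hg, Nat.cast_sum]

end digraphSystem

theorem IsTileCountingFunction.comp_add {f : ℕ → ℕ} (hf : IsTileCountingFunction f) (k : ℕ) :
    IsTileCountingFunction fun n => f (n + k) := by
  obtain ⟨ε, hε, T, hT, hT', hcount⟩ := hf
  refine ⟨k + ε, by positivity, T, hT, hT', fun n => ?_⟩
  rw [← hcount (n + k), Nat.cast_add, add_assoc]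

open Classical in
theorem isTileCountingFunction_of_digraph {κ : Type*} [Fintype κ] (start finish : κ → Prop)
    (step : κ → κ → Prop) (g : ℕ → κ → ℕ) (hg₀ : ∀ x, g 0 x = if finish x then 1 else 0)
    (hg : ∀ n x, g (n + 1) x = ∑ y with step x y, g n y) :
    IsTileCountingFunction fun n => ∑ x with start x, g n x := by
  have : Infinite (Ioo (0 : ℝ) (1 / 2)) := (Ioo_infinite (by norm_num)).to_subtype
  obtain ⟨index⟩ := nonempty_embedding_nat κ
  let S := digraphSystem (index.trans (Infinite.natEmbedding _)) start finish step
  refine ⟨1 + √2, by positivity, S.tiles, S.finite_tiles,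
    fun _ => TileSystem.isTallTile_of_mem_tiles, fun n => ?_⟩
  set a : ℝ := n + (1 + √2) with ha
  calc {C | IsTiling S.tiles (rectangle a) C}.encard = S.tilingCount none 0 none a := by
        rw [rectangle_eq_shape (by positivity)]
        rfl
    _ = S.tilingCount none (a - (n + 1 : ℕ) - √2) none a := by
        congr 1
        rw [ha]
        push_cast
        ring
    _ = ∑ x with start x, S.tilingCount (some x) (a - (n + 1 : ℕ)) none a :=
        digraphSystem.tilingCount_eq_sum_some a n none
    _ = (∑ x with start x, g n x : ℕ) := by
        simp only [S, digraphSystem.tilingCount_some hg₀ hg, Nat.cast_sum]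

theorem sum_filter_val_lt {ι R : Type*} [Fintype ι] [AddCommMonoid R] {M : ℕ} {c : ι → ℕ}
    (hc : ∀ i, c i ≤ M) (g : ι → R) :
    ∑ x : ι × Fin M with (x.2 : ℕ) < c x.1, g x.1 = ∑ i, c i • g i := by
  rw [Finset.sum_filter, Fintype.sum_prod_type]
  refine Finset.sum_congr rfl fun i _ => ?_
  rw [← Finset.sum_filter]
  simp [Fin.card_filter_val_lt, hc i]

theorem isTileCountingFunction_dotProduct_of_le_one {ι : Type*} [Fintype ι] (u : ι → ℕ)
    (A : Matrix ι ι ℕ) (g : ℕ → ι → ℕ) (hg₀ : ∀ i, g 0 i ≤ 1) (hg : ∀ n, g (n + 1) = A *ᵥ g n) :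
    IsTileCountingFunction fun n => u ⬝ᵥ g n := by
  obtain ⟨M, hM⟩ := (finite_range (Sum.elim u (Function.uncurry A))).bddAbove
  have hu (i : ι) : u i ≤ M := hM ⟨.inl i, rfl⟩
  have hA (i j : ι) : A i j ≤ M := hM ⟨.inr (i, j), rfl⟩
  -- Arcs have multiplicities `A i j`, which are realized by the first `A i j` of `M` copies of `j`.
  convert isTileCountingFunction_of_digraph (κ := ι × Fin M) (fun x => (x.2 : ℕ) < u x.1)
    (fun x => g 0 x.1 = 1) (fun x y => (y.2 : ℕ) < A x.1 y.1) (fun n x => g n x.1) ?_ ?_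
    using 2 with n
  · exact (sum_filter_val_lt hu (g n)).symm.trans (by congr)
  · grind
  · intro n x
    rw [hg]
    exact (sum_filter_val_lt (hA x.1) (g n)).symm.trans (by congr)

theorem isTileCountingFunction_dotProduct {ι : Type*} [Fintype ι] (u : ι → ℕ)
    (A : Matrix ι ι ℕ) (g : ℕ → ι → ℕ) (hg : ∀ n, g (n + 1) = A *ᵥ g n) :
    IsTileCountingFunction fun n => u ⬝ᵥ g n := by
  -- A final vertex, entered from `i` by `g 0 i` arcs, reduces to initial values `0` and `1`.
  let delayed : ℕ → ι ⊕ Unit → ℕ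
    | 0 => Sum.elim 0 1
    | n + 1 => Sum.elim (g n) 0
  have delayed_succ (n : ℕ) : delayed (n + 1) =
      Matrix.fromBlocks A (Matrix.replicateCol Unit (g 0)) 0 0 *ᵥ delayed n := by
    cases n <;> ext (_ | _) <;>
      simp [delayed, hg, Matrix.mulVec, dotProduct]
  have := isTileCountingFunction_dotProduct_of_le_one (Sum.elim u 0) _ delayed
    (by rintro (_ | _) <;> simp [delayed]) delayed_succ
  simpa [delayed] using this.comp_add 1

theorem isTileCountingFunction_of_isSolution (E : LinearRecurrence ℕ) {f : ℕ → ℕ}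
    (hf : E.IsSolution f) : IsTileCountingFunction f := by
  let window (n : ℕ) (i : Fin E.order) : ℕ := f (n + i)
  have window_succ (n : ℕ) : window (n + 1) = LinearMap.toMatrix' E.tupleSucc *ᵥ window n := by
    ext i
    simp only [window, LinearMap.toMatrix'_mulVec, LinearRecurrence.tupleSucc, LinearMap.coe_mk,
      AddHom.coe_mk, ← hf n]
    grind
  convert isTileCountingFunction_dotProduct (fun i : Fin E.order => if (i : ℕ) = 0 then 1 else 0) _
    window window_succ using 2 with n
  rw [dotProduct, ← Finset.sum_range fun i => (if i = 0 then 1 else 0) * f (n + i)]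
  rcases E with ⟨_ | d, c⟩
  · simpa [LinearRecurrence.IsSolution] using hf n
  · simp

theorem isTileCountingFunction_of_finite_support {f : ℕ → ℕ} (hf : (Function.support f).Finite) :
    IsTileCountingFunction f := by
  obtain ⟨K, hK⟩ := hf.bddAbove
  refine isTileCountingFunction_of_isSolution ⟨K + 1, 0⟩ fun n => ?_
  have : n + (K + 1) ∉ Function.support f := fun h => by linarith [hK h]
  simpa using this

theorem isTileCountingFunction_of_periodic {f : ℕ → ℕ} {p : ℕ} (hp : 0 < p)
    (hf : Function.Periodic f p) : IsTileCountingFunction f := by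
  refine isTileCountingFunction_of_isSolution ⟨p, Pi.single ⟨0, hp⟩ 1⟩ fun n => ?_
  simp [hf n, Pi.single_apply]

theorem isTileCountingFunction_pow (m : ℕ) : IsTileCountingFunction fun n => m ^ n :=
  isTileCountingFunction_of_isSolution ⟨1, fun _ => m⟩ fun n => by simp [pow_succ']

theorem isTileCountingFunction_polynomial_eval (P : Polynomial ℕ) :
    IsTileCountingFunction fun n => P.eval n := by
  let powers (n : ℕ) (i : Fin (P.natDegree + 1)) : ℕ := n ^ (i : ℕ)
  have powers_succ (n : ℕ) : powers (n + 1) =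
      (Matrix.of fun i j : Fin (P.natDegree + 1) => (i : ℕ).choose j) *ᵥ powers n := by
    ext i
    calc (n + 1) ^ (i : ℕ) = ∑ j ∈ Finset.range (i + 1), (i : ℕ).choose j * n ^ j := by
          simp only [add_pow, one_pow, mul_one, mul_comm, Nat.cast_id]
      _ = ∑ j ∈ Finset.range (P.natDegree + 1), (i : ℕ).choose j * n ^ j := by
          refine Finset.sum_subset (Finset.range_subset_range.2 i.2) fun j _ hj => ?_
          rw [Nat.choose_eq_zero_of_lt (by simpa [Nat.lt_succ_iff] using hj), zero_mul]
      _ = _ := Finset.sum_range _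
  convert isTileCountingFunction_dotProduct (fun i : Fin (P.natDegree + 1) => P.coeff i) _ powers
    powers_succ using 2 with n
  rw [Polynomial.eval_eq_sum_range, Finset.sum_range, dotProduct]

theorem isTileCountingFunction_pow_sub_one {m : ℕ} (hm : 1 ≤ m) :
    IsTileCountingFunction fun n => m ^ n - 1 := by
  obtain ⟨k, rfl⟩ := Nat.exists_eq_add_of_le' hm
  have recurrence (n : ℕ) :
      ![(k + 1) ^ (n + 1) - 1, 1] = !![k + 1, k; 0, 1] *ᵥ ![(k + 1) ^ n - 1, 1] := by
    have key : (k + 1) ^ (n + 1) - 1 = ((k + 1) ^ n - 1) * (k + 1) + k := by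
      have := Nat.one_le_pow n _ hm
      zify [this, Nat.one_le_pow (n + 1) _ hm]
      ring
    ext i
    fin_cases i <;> simp [key, mul_comm]
  simpa using isTileCountingFunction_dotProduct ![1, 0] _
    (fun n => ![(k + 1) ^ n - 1, 1]) recurrence

end IrrationalTiling

theorem corollaryc :
    (∀ f : ℕ → ℕ, (Function.support f).Finite →
      IrrationalTiling.IsTileCountingFunction f) ∧
    (∀ (f : ℕ → ℕ) (p : ℕ), 0 < p → Function.Periodic f p →
      IrrationalTiling.IsTileCountingFunction f) ∧
    (∀ P : Polynomial ℕ, IrrationalTiling.IsTileCountingFunction (fun n => P.eval n)) ∧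
    (∀ m : ℕ, IrrationalTiling.IsTileCountingFunction (fun n => m ^ n)) ∧
    (∀ m : ℕ, 1 ≤ m → IrrationalTiling.IsTileCountingFunction (fun n => m ^ n - 1)) :=
  ⟨fun _ => IrrationalTiling.isTileCountingFunction_of_finite_support,
    fun _ _ => IrrationalTiling.isTileCountingFunction_of_periodic,
    IrrationalTiling.isTileCountingFunction_polynomial_eval,
    IrrationalTiling.isTileCountingFunction_pow,
    fun _ => IrrationalTiling.isTileCountingFunction_pow_sub_one⟩
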